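/- Let $n\ge 1$, let $\Omega\subset\mathbb R^n$ be a bounded domain with $C^\infty$ boundary, and for $\delta\in(0,\infty)$ let $S_\delta=\{(x,y)\in\mathbb R^{2n}: |x-y|\le\delta\}$. For $t\in(0,1)$ let $$H^t_\Omega=\{v\in H^t(\mathbb R^n): v=0 \text{ a.e. on } \mathbb R^n\setminus\Omega\},\qquad \|v\|_{H^t_\Omega}^2=\int_{\mathbb R^n}\int_{\mathbb R^n}\frac{|v(x)-v(y)|^2}{|x-y|^{n+2t}}\,dy\,dx .$$ For functions $u,v$ on $\mathbb R^n$ put $$a(u,v;s)=\int_{S_\delta}\frac{(u(x)-u(y))(v(x)-v(y))}{|x-y|^{n+2s}}\,dy\,dx,\qquad a_s^{(k)}(u,v;s)=(-2)^k\int_{S_\delta}\frac{(u(x)-u(y))(v(x)-v(y))\log^k|x-y|}{|x-y|^{n+2s}}\,dy\,dx .$$ Let $k\ge 1$ be an integer and $\theta\in(0,1)$. Then there is a function $C=C_{\Omega,k,\theta}(s,\alpha)$, continuous on $\{(s,\alpha): 0<s<1,\ 0<\alpha<1-s\}$, such that for all $\delta\in(0,\infty)$, all $s\in(0,1)$, all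 $\alpha\in(0,1-s)$, and all $u\in H^{s+\alpha}_\Omega$, $v\in H^s_\Omega$ the following hold. 1. For every $\sigma\in[s,s+\alpha/2)$ the integral defining $a_s^{(k)}(u,v;\sigma)$ converges absolutely, the function $a(u,v;\cdot)$ is of class $C^k$ near $\sigma$, and $a_s^{(k)}(u,v;\sigma)$ is its $k$-th derivative at $\sigma$. 2. The derivative $a_s^{(k)}$ is locally Lipschitz continuous in $s$: for all $\eta$ with $0<\eta\le\theta\,\alpha/2$, $$|a_s^{(k)}(u,v;s)-a_s^{(k)}(u,v;s+\eta)|\le C(s,\alpha)\,\eta\,\|u\|_{H^{s+\alpha}_\Omega}\|v\|_{H^s_\Omega}.$$ -/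

import Mathlib

open MeasureTheory Set
open scoped ContDiff

noncomputable section

namespace NonlocalForm

/-- `Ω ⊆ ℝⁿ` is a bounded domain (non-empty, open, connected) with `C^∞` boundary: near each boundary
point, `Ω` is the sublevel set `{ρ < 0}` of a smooth function `ρ` with non-vanishing differential. -/
structure IsSmoothBoundedDomain {n : ℕ} (Ω : Set (EuclideanSpace ℝ (Fin n))) : Prop where
  isOpen : IsOpen Ω
  isConnected : IsConnected Ω
  isBounded : Bornology.IsBounded Ω
  smooth_boundary : ∀ x ∈ frontier Ω, ∃ (U : Set (EuclideanSpace ℝ (Fin n)))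
    (ρ : EuclideanSpace ℝ (Fin n) → ℝ), IsOpen U ∧ x ∈ U ∧ ContDiffOn ℝ ∞ ρ U ∧
      (∀ y ∈ U, fderiv ℝ ρ y ≠ 0) ∧ Ω ∩ U = {y ∈ U | ρ y < 0} ∧
      frontier Ω ∩ U = {y ∈ U | ρ y = 0}

/-- The squared Gagliardo seminorm
`|v|²_{H^s(ℝⁿ)} = ∫_{ℝⁿ} ∫_{ℝⁿ} |v(x) - v(y)|² / |x - y|^{n+2s} dy dx`, with values in `[0, ∞]`. -/
def gagliardoSq {n : ℕ} (s : ℝ) (v : EuclideanSpace ℝ (Fin n) → ℝ) : ENNReal :=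
  ∫⁻ x, ∫⁻ y, ENNReal.ofReal (|v x - v y| ^ 2 / ‖x - y‖ ^ ((n : ℝ) + 2 * s))

/-- Membership in `H^s_Ω = {v ∈ H^s(ℝⁿ) : v = 0 a.e. on ℝⁿ \ Ω}`, for `s ∈ (0, 1)`. -/
structure MemHOmega {n : ℕ} (Ω : Set (EuclideanSpace ℝ (Fin n))) (s : ℝ)
    (v : EuclideanSpace ℝ (Fin n) → ℝ) : Prop where
  memLp : MemLp v 2 volume
  gagliardoSq_lt_top : gagliardoSq s v < ⊤
  eq_zero : ∀ᵐ x ∂volume, x ∉ Ω → v x = 0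

/-- The norm of `H^s_Ω`, which is the Gagliardo seminorm of `H^s(ℝⁿ)`. -/
def normHOmega {n : ℕ} (s : ℝ) (v : EuclideanSpace ℝ (Fin n) → ℝ) : ℝ :=
  Real.sqrt (gagliardoSq s v).toReal

/-- The strip `S_δ = {(x, y) : |x - y| ≤ δ}`. -/
def strip (n : ℕ) (δ : ℝ) : Set (EuclideanSpace ℝ (Fin n) × EuclideanSpace ℝ (Fin n)) :=
  {p | ‖p.1 - p.2‖ ≤ δ}

/-- The bilinear form `a(u, v; s) = ∫_{S_δ} (u(x) - u(y)) (v(x) - v(y)) / |x - y|^{n+2s} dy dx`. -/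
def bilinForm {n : ℕ} (δ : ℝ) (u v : EuclideanSpace ℝ (Fin n) → ℝ) (s : ℝ) : ℝ :=
  ∫ p in strip n δ, (u p.1 - u p.2) * (v p.1 - v p.2) / ‖p.1 - p.2‖ ^ ((n : ℝ) + 2 * s)

/-- The integrand `(u(x) - u(y)) (v(x) - v(y)) log^k |x - y| / |x - y|^{n+2s}`. -/
def derivIntegrand {n : ℕ} (k : ℕ) (u v : EuclideanSpace ℝ (Fin n) → ℝ) (s : ℝ)
    (p : EuclideanSpace ℝ (Fin n) × EuclideanSpace ℝ (Fin n)) : ℝ :=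
  (u p.1 - u p.2) * (v p.1 - v p.2) * Real.log ‖p.1 - p.2‖ ^ k /
    ‖p.1 - p.2‖ ^ ((n : ℝ) + 2 * s)

/-- `a_s^{(k)}(u, v; s)`, the `k`-th derivative of `a(u, v; ·)`, as the integral
`(-2)^k ∫_{S_δ} (u(x) - u(y)) (v(x) - v(y)) log^k |x - y| / |x - y|^{n+2s} dy dx`. -/
def bilinFormDeriv {n : ℕ} (k : ℕ) (δ : ℝ) (u v : EuclideanSpace ℝ (Fin n) → ℝ) (s : ℝ) : ℝ :=
  (-2) ^ k * ∫ p in strip n δ, derivIntegrand k u v s p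

end NonlocalForm

end

noncomputable section

namespace NonlocalForm

/-! For `u` in `H^{s+α}_Ω` and `v` in `H^s_Ω`, the kernel that Cauchy–Schwarz controls near the
diagonal is `r ^ (-(n + 2s + α))`. It exceeds `r ^ (-(n + 2σ))` by the factor `r ^ (-(2s + α -
2σ))`, and for `σ < s + α/2` this positive gap absorbs any power of the logarithm.

For `r > 1` the comparison reverses, so both half kernels continue with the slower decay `r ^ (-(n +
ε)/2)`, `ε < 2σ`. This tail is still integrable, hence costs only the `L²` norm, which a Poincaré
inequality bounds by the seminorm as `Ω` is bounded (`lintegral_sq_sub_mul_halfKernel_le`). All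
estimates hold on the whole space, hence uniformly in `δ`.

The pointwise majorant `abs_derivIntegrand_le` permits differentiation under the integral
(`hasDerivAt_bilinFormDeriv`). The Lipschitz estimate is the mean value inequality with the bound
`abs_bilinFormDeriv_le` on the derivative of order `k + 1`. -/

/-- The square root of the kernel `r ^ (-(n + 2t))` for `r ≤ 1`, continued by that of
`r ^ (-(n + ε))` for `r > 1`. -/
def halfKernel (n : ℕ) (t ε r : ℝ) : ℝ :=
  if r ≤ 1 then r ^ (-((n : ℝ) / 2 + t)) else r ^ (-(((n : ℝ) + ε) / 2))

/-- The tail `r ^ (-(n + ε))`, `r > 1`, of a radial kernel. -/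
def tailKernel (n : ℕ) (ε r : ℝ) : ℝ :=
  (Ioi (1 : ℝ)).indicator (fun r => r ^ (-((n : ℝ) + ε))) r

lemma measurable_halfKernel (n : ℕ) (t ε : ℝ) : Measurable (halfKernel n t ε) :=
  Measurable.ite measurableSet_Iic (by fun_prop) (by fun_prop)

lemma measurable_tailKernel (n : ℕ) (ε : ℝ) : Measurable (tailKernel n ε) :=
  Measurable.indicator (by fun_prop) measurableSet_Ioi

lemma tailKernel_nonneg (n : ℕ) (ε r : ℝ) : 0 ≤ tailKernel n ε r :=
  indicator_nonneg (fun _ hr => Real.rpow_nonneg (zero_le_one.trans (le_of_lt hr)) _) r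

lemma halfKernel_nonneg (n : ℕ) (t ε : ℝ) {r : ℝ} (hr : 0 ≤ r) : 0 ≤ halfKernel n t ε r := by
  unfold halfKernel
  split_ifs <;> positivity

lemma halfKernel_mul_of_le_one (n : ℕ) (t t' ε : ℝ) {r : ℝ} (hr : 0 < r) (h1 : r ≤ 1) :
    halfKernel n t ε r * halfKernel n t' ε r = r ^ (-((n : ℝ) + t + t')) := by
  simp only [halfKernel, if_pos h1]
  rw [← Real.rpow_add hr]
  congr 1
  ring

lemma halfKernel_mul_of_one_lt (n : ℕ) (t t' ε : ℝ) {r : ℝ} (h1 : 1 < r) :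
    halfKernel n t ε r * halfKernel n t' ε r = r ^ (-((n : ℝ) + ε)) := by
  simp only [halfKernel, if_neg h1.not_ge]
  rw [← Real.rpow_add (zero_lt_one.trans h1)]
  congr 1
  ring

lemma sq_mul_halfKernel_le (n : ℕ) (t ε d : ℝ) {r : ℝ} (hr : 0 ≤ r) (hd : r = 0 → d = 0) :
    (d * halfKernel n t ε r) ^ 2 ≤
      |d| ^ 2 / r ^ ((n : ℝ) + 2 * t) + d ^ 2 * tailKernel n ε r := by
  rcases hr.eq_or_lt with rfl | hr
  · simp [hd rfl]
  rw [mul_pow, sq (halfKernel n t ε r)]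
  rcases le_or_gt r 1 with h1 | h1
  · rw [halfKernel_mul_of_le_one n t t ε hr h1, sq_abs, div_eq_mul_inv, ← Real.rpow_neg hr.le,
      show (n : ℝ) + t + t = n + 2 * t by ring]
    exact le_add_of_nonneg_right (mul_nonneg (sq_nonneg _) (tailKernel_nonneg _ _ _))
  · rw [halfKernel_mul_of_one_lt n t t ε h1, tailKernel, indicator_of_mem (mem_Ioi.2 h1)]
    exact le_add_of_nonneg_left (by positivity)

/-- In polar coordinates the mass is `n |B₁| ∫_1^∞ r ^ (-1 - ε) dr`. The factor `|B₁|` is kept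
because the Poincaré inequality below bounds its product with the squared `L²` norm. -/
lemma lintegral_tailKernel {n : ℕ} (hn : 1 ≤ n) {ε : ℝ} (hε : 0 < ε) :
    ∫⁻ z : EuclideanSpace ℝ (Fin n), ENNReal.ofReal (tailKernel n ε ‖z‖) =
      ENNReal.ofReal (n / ε) * volume (Metric.ball (0 : EuclideanSpace ℝ (Fin n)) 1) := by
  have : Nonempty (Fin n) := ⟨⟨0, hn⟩⟩
  have hfun : ∀ y ∈ Ioi (0 : ℝ), y ^ (n - 1) • tailKernel n ε y =
      (Ioi (1 : ℝ)).indicator (fun r => r ^ (-1 - ε)) y := by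
    intro y hy
    by_cases h1 : y ∈ Ioi (1 : ℝ)
    · rw [tailKernel, indicator_of_mem h1, indicator_of_mem h1, smul_eq_mul, ← Real.rpow_natCast,
        ← Real.rpow_add hy, Nat.cast_sub hn]
      congr 1
      push_cast
      ring
    · rw [tailKernel, indicator_of_notMem h1, indicator_of_notMem h1, smul_zero]
  have hsub : Ioi (1 : ℝ) ⊆ Ioi 0 := Ioi_subset_Ioi zero_le_one
  have hint : Integrable (fun z : EuclideanSpace ℝ (Fin n) => tailKernel n ε ‖z‖) := by
    rw [integrable_fun_norm_addHaar, finrank_euclideanSpace_fin,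
      integrableOn_congr_fun hfun measurableSet_Ioi]
    exact IntegrableOn.integrable_indicator (integrableOn_Ioi_rpow_of_lt (by linarith) zero_lt_one)
      measurableSet_Ioi |>.integrableOn
  rw [← ofReal_integral_eq_lintegral_ofReal hint (ae_of_all _ fun z => tailKernel_nonneg _ _ _),
    integral_fun_norm_addHaar, finrank_euclideanSpace_fin,
    setIntegral_congr_fun measurableSet_Ioi hfun, setIntegral_indicator measurableSet_Ioi,
    inter_eq_self_of_subset_right hsub, integral_Ioi_rpow_of_lt (by linarith) zero_lt_one,
    Real.one_rpow, nsmul_eq_mul, smul_eq_mul,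
    ← ENNReal.ofReal_toReal (measure_ball_lt_top (μ := volume)
      (x := (0 : EuclideanSpace ℝ (Fin n))) (r := 1)).ne,
    ← ENNReal.ofReal_mul (by positivity)]
  congr 1
  rw [show -1 - ε + 1 = -ε by ring, neg_div_neg_eq, Measure.real]
  ring

/-! ### Poincaré inequality and weighted energy -/

/-- A Poincaré inequality for functions which vanish outside a bounded set. -/
lemma lintegral_sq_mul_volume_ball_le {n : ℕ} (hn : 1 ≤ n) {Ω : Set (EuclideanSpace ℝ (Fin n))}
    {R : ℝ} (hR : 0 < R) (hΩ : Ω ⊆ Metric.closedBall 0 R) {t : ℝ} (ht : 0 < t)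
    {v : EuclideanSpace ℝ (Fin n) → ℝ} (hv : ∀ᵐ x ∂volume, x ∉ Ω → v x = 0) :
    (∫⁻ x, ENNReal.ofReal (v x ^ 2)) * volume (Metric.ball (0 : EuclideanSpace ℝ (Fin n)) 1) ≤
      ENNReal.ofReal ((2 * R + 2) ^ ((n : ℝ) + 2 * t)) * gagliardoSq t v := by
  -- The unit ball about `z` misses `Ω`, so there `v x - v y = v x` for a.e. `y`. Its points lie
  -- within `R + (R + 2)` of any point of `Ω`.
  obtain ⟨z, hz⟩ : ∃ z : EuclideanSpace ℝ (Fin n), ‖z‖ = R + 1 :=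
    ⟨EuclideanSpace.single ⟨0, hn⟩ (R + 1), by simp [abs_of_pos (by linarith : 0 < R + 1)]⟩
  have hc : 0 ≤ (2 * R + 2) ^ ((n : ℝ) + 2 * t) := by positivity
  rw [← Measure.addHaar_ball_center volume z, gagliardoSq,
    ← lintegral_const_mul' _ _ ENNReal.ofReal_ne_top,
    ← lintegral_mul_const' _ _ (measure_ball_lt_top).ne]
  refine lintegral_mono_ae ?_
  filter_upwards [hv] with x hx
  by_cases hxΩ : x ∈ Ω
  swap
  · simp [hx hxΩ]
  rw [← setLIntegral_const, ← lintegral_const_mul' _ _ ENNReal.ofReal_ne_top]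
  refine le_trans ?_ (setLIntegral_le_lintegral (Metric.ball z 1) _)
  refine lintegral_mono_ae ?_
  filter_upwards [ae_restrict_of_ae hv, ae_restrict_mem Metric.isOpen_ball.measurableSet]
    with y hy hyz
  have hxR : ‖x‖ ≤ R := by simpa using hΩ hxΩ
  rw [Metric.mem_ball, dist_eq_norm] at hyz
  have h1 : ‖z‖ ≤ ‖y‖ + ‖y - z‖ := by
    simpa using norm_sub_le y (y - z)
  have h2 : ‖y‖ ≤ ‖z‖ + ‖y - z‖ := by
    simpa using norm_add_le z (y - z)
  have hyΩ : y ∉ Ω := fun h => by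
    have : ‖y‖ ≤ R := by simpa using hΩ h
    linarith
  have hxy : 0 < ‖x - y‖ := by
    rw [norm_pos_iff, sub_ne_zero]
    rintro rfl
    exact hyΩ hxΩ
  have hle : ‖x - y‖ ≤ 2 * R + 2 := by linarith [norm_sub_le x y]
  rw [hy hyΩ, sub_zero, sq_abs, ← ENNReal.ofReal_mul hc]
  refine ENNReal.ofReal_le_ofReal ?_
  rw [← mul_div_assoc, le_div_iff₀ (by positivity), mul_comm]
  exact mul_le_mul_of_nonneg_right (Real.rpow_le_rpow hxy.le hle (by positivity)) (sq_nonneg _)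

/-- Since `(a - b)² ≤ 2a² + 2b²`, Tonelli and translation invariance reduce each term to the squared
`L²` norm times the mass of the tail. -/
lemma lintegral_sq_sub_mul_tailKernel_le {n : ℕ} (hn : 1 ≤ n) {ε : ℝ} (hε : 0 < ε)
    {v : EuclideanSpace ℝ (Fin n) → ℝ} (hv : AEStronglyMeasurable v volume) :
    ∫⁻ p : EuclideanSpace ℝ (Fin n) × EuclideanSpace ℝ (Fin n),
        ENNReal.ofReal ((v p.1 - v p.2) ^ 2 * tailKernel n ε ‖p.1 - p.2‖) ≤
      4 * ENNReal.ofReal (n / ε) * ((∫⁻ x, ENNReal.ofReal (v x ^ 2)) *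
        volume (Metric.ball (0 : EuclideanSpace ℝ (Fin n)) 1)) := by
  set F : EuclideanSpace ℝ (Fin n) → ENNReal := fun z => ENNReal.ofReal (tailKernel n ε ‖z‖)
    with hF
  set A : EuclideanSpace ℝ (Fin n) → ENNReal := fun x => ENNReal.ofReal (v x ^ 2) with hA
  have hFm : Measurable F := ((measurable_tailKernel n ε).comp measurable_norm).ennreal_ofReal
  have hAm : AEMeasurable A volume := (hv.aemeasurable.pow_const 2).ennreal_ofReal
  have hFm2 : Measurable fun p : EuclideanSpace ℝ (Fin n) × EuclideanSpace ℝ (Fin n) =>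
      F (p.1 - p.2) := hFm.comp (measurable_fst.sub measurable_snd)
  have hA1 : AEMeasurable (fun p : EuclideanSpace ℝ (Fin n) × EuclideanSpace ℝ (Fin n) => A p.1)
      (volume.prod volume) := hAm.comp_fst
  have hA2 : AEMeasurable (fun p : EuclideanSpace ℝ (Fin n) × EuclideanSpace ℝ (Fin n) => A p.2)
      (volume.prod volume) := hAm.comp_snd
  have hAF1 : AEMeasurable (fun p : EuclideanSpace ℝ (Fin n) × EuclideanSpace ℝ (Fin n) =>
      A p.1 * F (p.1 - p.2)) (volume.prod volume) := hA1.mul hFm2.aemeasurable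
  have hAF2 : AEMeasurable (fun p : EuclideanSpace ℝ (Fin n) × EuclideanSpace ℝ (Fin n) =>
      A p.2 * F (p.1 - p.2)) (volume.prod volume) := hA2.mul hFm2.aemeasurable
  have hpt : ∀ p : EuclideanSpace ℝ (Fin n) × EuclideanSpace ℝ (Fin n),
      ENNReal.ofReal ((v p.1 - v p.2) ^ 2 * tailKernel n ε ‖p.1 - p.2‖) ≤
        2 * (A p.1 * F (p.1 - p.2)) + 2 * (A p.2 * F (p.1 - p.2)) := by
    intro p
    have hk := tailKernel_nonneg n ε ‖p.1 - p.2‖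
    simp only [hA, hF]
    generalize tailKernel n ε ‖p.1 - p.2‖ = κ at hk ⊢
    rw [← ENNReal.ofReal_mul (sq_nonneg _), ← ENNReal.ofReal_mul (sq_nonneg _),
      ← ENNReal.ofReal_ofNat 2, ← ENNReal.ofReal_mul zero_le_two,
      ← ENNReal.ofReal_mul zero_le_two, ← ENNReal.ofReal_add (by positivity) (by positivity)]
    refine ENNReal.ofReal_le_ofReal ?_
    nlinarith [mul_nonneg (sq_nonneg (v p.1 + v p.2)) hk]
  have h1 : ∫⁻ p : EuclideanSpace ℝ (Fin n) × EuclideanSpace ℝ (Fin n), A p.1 * F (p.1 - p.2) =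
      (∫⁻ x, A x) * ∫⁻ z, F z := by
    rw [Measure.volume_eq_prod, lintegral_prod _ hAF1,
      ← lintegral_mul_const'' _ hAm]
    refine lintegral_congr fun x => ?_
    dsimp only
    rw [lintegral_const_mul' _ _ ENNReal.ofReal_ne_top,
      lintegral_sub_left_eq_self]
  have h2 : ∫⁻ p : EuclideanSpace ℝ (Fin n) × EuclideanSpace ℝ (Fin n), A p.2 * F (p.1 - p.2) =
      (∫⁻ x, A x) * ∫⁻ z, F z := by
    rw [Measure.volume_eq_prod, lintegral_prod_symm _ hAF2,
      ← lintegral_mul_const'' _ hAm]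
    refine lintegral_congr fun x => ?_
    dsimp only
    rw [lintegral_const_mul' _ _ ENNReal.ofReal_ne_top,
      lintegral_sub_right_eq_self]
  refine (lintegral_mono hpt).trans ?_
  rw [Measure.volume_eq_prod, lintegral_add_left' (hAF1.const_mul 2), ← Measure.volume_eq_prod,
    lintegral_const_mul' _ _ ENNReal.ofNat_ne_top, lintegral_const_mul' _ _ ENNReal.ofNat_ne_top,
    h1, h2, hF, lintegral_tailKernel hn hε]
  refine le_of_eq ?_
  ring

/-- The constant in the bound of the weighted energy by the Gagliardo seminorm. -/
def energyConst (n : ℕ) (R t ε : ℝ) : ℝ :=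
  1 + 4 * (n / ε) * (2 * R + 2) ^ ((n : ℝ) + 2 * t)

lemma lintegral_sq_sub_mul_halfKernel_le {n : ℕ} (hn : 1 ≤ n)
    {Ω : Set (EuclideanSpace ℝ (Fin n))} {R : ℝ} (hR : 0 < R) (hΩ : Ω ⊆ Metric.closedBall 0 R)
    {t ε : ℝ} (ht : 0 < t) (hε : 0 < ε) {v : EuclideanSpace ℝ (Fin n) → ℝ}
    (hv : MemHOmega Ω t v) :
    ∫⁻ p : EuclideanSpace ℝ (Fin n) × EuclideanSpace ℝ (Fin n),
        ENNReal.ofReal (((v p.1 - v p.2) * halfKernel n t ε ‖p.1 - p.2‖) ^ 2) ≤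
      ENNReal.ofReal (energyConst n R t ε) * gagliardoSq t v := by
  have hvm := hv.memLp.1.aemeasurable
  have hd : AEMeasurable (fun p : EuclideanSpace ℝ (Fin n) × EuclideanSpace ℝ (Fin n) =>
      v p.1 - v p.2) (volume.prod volume) := hvm.comp_fst.sub hvm.comp_snd
  have hm : AEMeasurable (fun p : EuclideanSpace ℝ (Fin n) × EuclideanSpace ℝ (Fin n) =>
      ENNReal.ofReal (|v p.1 - v p.2| ^ 2 / ‖p.1 - p.2‖ ^ ((n : ℝ) + 2 * t)))
      (volume.prod volume) :=
    ((hd.abs.pow_const 2).div (Measurable.aemeasurable (by fun_prop))).ennreal_ofReal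
  have hg : ∫⁻ p : EuclideanSpace ℝ (Fin n) × EuclideanSpace ℝ (Fin n),
      ENNReal.ofReal (|v p.1 - v p.2| ^ 2 / ‖p.1 - p.2‖ ^ ((n : ℝ) + 2 * t)) =
      gagliardoSq t v := by
    rw [Measure.volume_eq_prod, lintegral_prod _ hm, gagliardoSq]
  have htail := (lintegral_sq_sub_mul_tailKernel_le hn hε hv.memLp.1).trans
    (mul_le_mul_right (lintegral_sq_mul_volume_ball_le hn hR hΩ ht hv.eq_zero) _)
  calc ∫⁻ p : EuclideanSpace ℝ (Fin n) × EuclideanSpace ℝ (Fin n),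
        ENNReal.ofReal (((v p.1 - v p.2) * halfKernel n t ε ‖p.1 - p.2‖) ^ 2)
      ≤ ∫⁻ p : EuclideanSpace ℝ (Fin n) × EuclideanSpace ℝ (Fin n),
        (ENNReal.ofReal (|v p.1 - v p.2| ^ 2 / ‖p.1 - p.2‖ ^ ((n : ℝ) + 2 * t)) +
          ENNReal.ofReal ((v p.1 - v p.2) ^ 2 * tailKernel n ε ‖p.1 - p.2‖)) := by
        refine lintegral_mono fun p => ?_
        rw [← ENNReal.ofReal_add (by positivity)
          (mul_nonneg (sq_nonneg _) (tailKernel_nonneg _ _ _))]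
        refine ENNReal.ofReal_le_ofReal (sq_mul_halfKernel_le n t ε _ (norm_nonneg _) fun h => ?_)
        rw [norm_eq_zero, sub_eq_zero] at h
        rw [h, sub_self]
    _ ≤ gagliardoSq t v + 4 * ENNReal.ofReal (n / ε) *
          (ENNReal.ofReal ((2 * R + 2) ^ ((n : ℝ) + 2 * t)) * gagliardoSq t v) := by
        rw [Measure.volume_eq_prod, lintegral_add_left' hm, ← Measure.volume_eq_prod, hg]
        exact add_le_add_right htail _
    _ = ENNReal.ofReal (energyConst n R t ε) * gagliardoSq t v := by
        rw [energyConst, ENNReal.ofReal_add zero_le_one (by positivity),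
          ENNReal.ofReal_mul (by positivity), ENNReal.ofReal_mul (by positivity),
          ENNReal.ofReal_one, show ENNReal.ofReal 4 = 4 by simp]
        ring

lemma memLp_sub_mul_halfKernel {n : ℕ} (hn : 1 ≤ n)
    {Ω : Set (EuclideanSpace ℝ (Fin n))} {R : ℝ} (hR : 0 < R) (hΩ : Ω ⊆ Metric.closedBall 0 R)
    {t ε : ℝ} (ht : 0 < t) (hε : 0 < ε) {v : EuclideanSpace ℝ (Fin n) → ℝ}
    (hv : MemHOmega Ω t v) :
    MemLp (fun p : EuclideanSpace ℝ (Fin n) × EuclideanSpace ℝ (Fin n) =>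
        (v p.1 - v p.2) * halfKernel n t ε ‖p.1 - p.2‖) 2 ∧
      ∫ p : EuclideanSpace ℝ (Fin n) × EuclideanSpace ℝ (Fin n),
        ((v p.1 - v p.2) * halfKernel n t ε ‖p.1 - p.2‖) ^ 2 ≤
          energyConst n R t ε * normHOmega t v ^ 2 := by
  have hvm := hv.memLp.1
  have hm : AEStronglyMeasurable (fun p : EuclideanSpace ℝ (Fin n) × EuclideanSpace ℝ (Fin n) =>
      (v p.1 - v p.2) * halfKernel n t ε ‖p.1 - p.2‖) volume := by
    refine AEStronglyMeasurable.mul (hvm.comp_fst.sub hvm.comp_snd) ?_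
    exact ((measurable_halfKernel n t ε).comp (by fun_prop)).aestronglyMeasurable
  have hle := lintegral_sq_sub_mul_halfKernel_le hn hR hΩ ht hε hv
  have hP : 0 ≤ energyConst n R t ε := by unfold energyConst; positivity
  have hfin : ENNReal.ofReal (energyConst n R t ε) * gagliardoSq t v < ⊤ :=
    ENNReal.mul_lt_top ENNReal.ofReal_lt_top hv.gagliardoSq_lt_top
  refine ⟨(memLp_two_iff_integrable_sq hm).2 ⟨hm.pow 2, ?_⟩, ?_⟩
  · rw [hasFiniteIntegral_iff_ofReal (ae_of_all _ fun p => sq_nonneg _)]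
    exact hle.trans_lt hfin
  · rw [integral_eq_lintegral_of_nonneg_ae (ae_of_all _ fun p => sq_nonneg _) (hm.pow 2),
      normHOmega, Real.sq_sqrt ENNReal.toReal_nonneg]
    refine (ENNReal.toReal_mono hfin.ne hle).trans ?_
    rw [ENNReal.toReal_mul, ENNReal.toReal_ofReal hP]

/-! ### Absorbing the logarithms -/

lemma abs_log_pow_mul_rpow_le (m : ℕ) {γ r : ℝ} (hγ : 0 < γ) (hr : 0 < r) (h1 : r ≤ 1) :
    |Real.log r| ^ m * r ^ γ ≤ (m / γ) ^ m := by
  -- The exponent `γ / m` used below is positive only for `m > 0`; for `m = 0` the right-hand side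
  -- is `0 ^ 0 = 1`.
  rcases m.eq_zero_or_pos with rfl | hm
  · simpa using Real.rpow_le_one hr.le h1 hγ.le
  have hm' : (0 : ℝ) < m := Nat.cast_pos.2 hm
  have h := (Real.abs_log_mul_self_rpow_lt r (γ / m) hr h1 (by positivity)).le
  rw [abs_mul, abs_of_nonneg (Real.rpow_nonneg hr.le _), one_div_div] at h
  calc |Real.log r| ^ m * r ^ γ = (|Real.log r| * r ^ (γ / m)) ^ m := by
        rw [mul_pow, ← Real.rpow_mul_natCast hr.le, div_mul_cancel₀ _ hm'.ne']
    _ ≤ (m / γ) ^ m := pow_le_pow_left₀ (by positivity) h m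

lemma abs_log_pow_mul_rpow_neg_le (m : ℕ) {γ r : ℝ} (hγ : 0 < γ) (h1 : 1 ≤ r) :
    |Real.log r| ^ m * r ^ (-γ) ≤ (m / γ) ^ m := by
  have hr : 0 < r := zero_lt_one.trans_le h1
  have h := abs_log_pow_mul_rpow_le m hγ (inv_pos.2 hr) (inv_le_one_of_one_le₀ h1)
  rwa [Real.log_inv, abs_neg, Real.inv_rpow hr.le, ← Real.rpow_neg hr.le] at h

/-- The constant in the bound of the logarithmic kernels by a product of half kernels: `γ` and `γ'`
are the gaps of the exponents near the diagonal and at infinity. -/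
def logConst (m : ℕ) (γ γ' : ℝ) : ℝ :=
  (m / γ) ^ m + (m / γ') ^ m

/-- The gap `γ` pays for the logarithm when `r ≤ 1`, the gap `γ'` when `r > 1`. Stating the gaps as
inequalities makes one constant serve a whole interval of `σ`. -/
lemma abs_log_pow_div_rpow_le (n m : ℕ) {t t' ε γ γ' σ r : ℝ} (hγ : 0 < γ) (hγ' : 0 < γ')
    (h : 2 * σ + γ ≤ t + t') (h' : ε + γ' ≤ 2 * σ) (hr : 0 < r) :
    |Real.log r| ^ m / r ^ ((n : ℝ) + 2 * σ) ≤
      logConst m γ γ' * (halfKernel n t ε r * halfKernel n t' ε r) := by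
  have hc : (0 : ℝ) ≤ (m / γ) ^ m := by positivity
  have hc' : (0 : ℝ) ≤ (m / γ') ^ m := by positivity
  rw [div_eq_mul_inv, ← Real.rpow_neg hr.le]
  rcases le_or_gt r 1 with h1 | h1
  · rw [halfKernel_mul_of_le_one n t t' ε hr h1]
    calc |Real.log r| ^ m * r ^ (-((n : ℝ) + 2 * σ))
        ≤ |Real.log r| ^ m * r ^ (γ + -((n : ℝ) + t + t')) := by
          refine mul_le_mul_of_nonneg_left ?_ (by positivity)
          exact Real.rpow_le_rpow_of_exponent_ge hr h1 (by linarith)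
      _ = |Real.log r| ^ m * r ^ γ * r ^ (-((n : ℝ) + t + t')) := by
          rw [Real.rpow_add hr, mul_assoc]
      _ ≤ logConst m γ γ' * r ^ (-((n : ℝ) + t + t')) := by
          refine mul_le_mul_of_nonneg_right ?_ (by positivity)
          exact (abs_log_pow_mul_rpow_le m hγ hr h1).trans (le_add_of_nonneg_right hc')
  · rw [halfKernel_mul_of_one_lt n t t' ε h1]
    calc |Real.log r| ^ m * r ^ (-((n : ℝ) + 2 * σ))
        ≤ |Real.log r| ^ m * r ^ (-γ' + -((n : ℝ) + ε)) := by
          refine mul_le_mul_of_nonneg_left ?_ (by positivity)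
          exact Real.rpow_le_rpow_of_exponent_le h1.le (by linarith)
      _ = |Real.log r| ^ m * r ^ (-γ') * r ^ (-((n : ℝ) + ε)) := by
          rw [Real.rpow_add hr, mul_assoc]
      _ ≤ logConst m γ γ' * r ^ (-((n : ℝ) + ε)) := by
          refine mul_le_mul_of_nonneg_right ?_ (by positivity)
          exact (abs_log_pow_mul_rpow_neg_le m hγ' h1.le).trans (le_add_of_nonneg_left hc)

/-- The difference quotient of `v` with the weight `halfKernel`. -/
def weightedDiff {n : ℕ} (t ε : ℝ) (v : EuclideanSpace ℝ (Fin n) → ℝ)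
    (p : EuclideanSpace ℝ (Fin n) × EuclideanSpace ℝ (Fin n)) : ℝ :=
  |(v p.1 - v p.2) * halfKernel n t ε ‖p.1 - p.2‖|

lemma abs_derivIntegrand_le {n : ℕ} (m : ℕ) {t t' ε γ γ' σ : ℝ} (hγ : 0 < γ) (hγ' : 0 < γ')
    (h : 2 * σ + γ ≤ t + t') (h' : ε + γ' ≤ 2 * σ) (u v : EuclideanSpace ℝ (Fin n) → ℝ)
    (p : EuclideanSpace ℝ (Fin n) × EuclideanSpace ℝ (Fin n)) :
    |derivIntegrand m u v σ p| ≤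
      logConst m γ γ' * (weightedDiff t ε u p * weightedDiff t' ε v p) := by
  -- On the diagonal both sides vanish, because the differences do.
  rcases (norm_nonneg (p.1 - p.2)).eq_or_lt with h0 | hr
  · have : p.1 = p.2 := sub_eq_zero.1 (norm_eq_zero.1 h0.symm)
    simp [derivIntegrand, weightedDiff, this]
  simp only [weightedDiff, derivIntegrand, abs_mul, abs_div, abs_pow,
    abs_of_nonneg (halfKernel_nonneg n _ ε hr.le),
    abs_of_nonneg (Real.rpow_nonneg hr.le ((n : ℝ) + 2 * σ))]
  have hk := abs_log_pow_div_rpow_le n m hγ hγ' h h' hr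
  calc |u p.1 - u p.2| * |v p.1 - v p.2| * |Real.log ‖p.1 - p.2‖| ^ m /
        ‖p.1 - p.2‖ ^ ((n : ℝ) + 2 * σ)
      = |u p.1 - u p.2| * |v p.1 - v p.2| *
        (|Real.log ‖p.1 - p.2‖| ^ m / ‖p.1 - p.2‖ ^ ((n : ℝ) + 2 * σ)) := by ring
    _ ≤ |u p.1 - u p.2| * |v p.1 - v p.2| * (logConst m γ γ' *
        (halfKernel n t ε ‖p.1 - p.2‖ * halfKernel n t' ε ‖p.1 - p.2‖)) :=
        mul_le_mul_of_nonneg_left hk (by positivity)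
    _ = _ := by ring

lemma integrable_weightedDiff_mul {n : ℕ} (hn : 1 ≤ n) {Ω : Set (EuclideanSpace ℝ (Fin n))}
    {R : ℝ} (hR : 0 < R) (hΩ : Ω ⊆ Metric.closedBall 0 R) {t t' ε : ℝ} (ht : 0 < t) (ht' : 0 < t')
    (hε : 0 < ε) {u v : EuclideanSpace ℝ (Fin n) → ℝ} (hu : MemHOmega Ω t u)
    (hv : MemHOmega Ω t' v) :
    Integrable (fun p => weightedDiff t ε u p * weightedDiff t' ε v p) ∧
      ∫ p, weightedDiff t ε u p * weightedDiff t' ε v p ≤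
        √(energyConst n R t ε) * normHOmega t u *
          (√(energyConst n R t' ε) * normHOmega t' v) := by
  obtain ⟨hfu, hfu'⟩ := memLp_sub_mul_halfKernel hn hR hΩ ht hε hu
  obtain ⟨hgv, hgv'⟩ := memLp_sub_mul_halfKernel hn hR hΩ ht' hε hv
  have hf : MemLp (weightedDiff t ε u) 2 := hfu.abs
  have hg : MemLp (weightedDiff t' ε v) 2 := hgv.abs
  refine ⟨hf.integrable_mul hg, ?_⟩
  have h2 : ENNReal.ofReal 2 = 2 := ENNReal.ofReal_ofNat 2
  refine (integral_mul_le_Lp_mul_Lq_of_nonneg Real.HolderConjugate.two_two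
    (ae_of_all _ fun p => abs_nonneg _) (ae_of_all _ fun p => abs_nonneg _)
    (h2.symm ▸ hf) (h2.symm ▸ hg)).trans ?_
  simp only [Real.rpow_two, sq_abs, ← Real.sqrt_eq_rpow]
  have key : ∀ {I P N : ℝ}, 0 ≤ N → 0 ≤ P → I ≤ P * N ^ 2 → √I ≤ √P * N := by
    intro I P N hN hP h
    refine (Real.sqrt_le_sqrt h).trans ?_
    rw [Real.sqrt_mul hP, Real.sqrt_sq hN]
  have hP : ∀ t, 0 ≤ energyConst n R t ε := fun t => by unfold energyConst; positivity
  have hN : ∀ t (w : EuclideanSpace ℝ (Fin n) → ℝ), 0 ≤ normHOmega t w :=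
    fun t w => Real.sqrt_nonneg _
  exact mul_le_mul (key (hN _ _) (hP _) hfu') (key (hN _ _) (hP _) hgv')
    (Real.sqrt_nonneg _) (mul_nonneg (Real.sqrt_nonneg _) (hN _ _))

lemma aestronglyMeasurable_derivIntegrand {n : ℕ} (m : ℕ) (σ : ℝ)
    {u v : EuclideanSpace ℝ (Fin n) → ℝ} (hu : AEStronglyMeasurable u volume)
    (hv : AEStronglyMeasurable v volume) :
    AEStronglyMeasurable (derivIntegrand m u v σ) volume := by
  have hw : ∀ {w : EuclideanSpace ℝ (Fin n) → ℝ}, AEStronglyMeasurable w volume →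
      AEMeasurable (fun p : EuclideanSpace ℝ (Fin n) × EuclideanSpace ℝ (Fin n) =>
        w p.1 - w p.2) volume :=
    fun hw => (hw.comp_fst.sub hw.comp_snd).aemeasurable
  have hl : Measurable (fun p : EuclideanSpace ℝ (Fin n) × EuclideanSpace ℝ (Fin n) =>
      Real.log ‖p.1 - p.2‖ ^ m) := by fun_prop
  have hr : Measurable (fun p : EuclideanSpace ℝ (Fin n) × EuclideanSpace ℝ (Fin n) =>
      ‖p.1 - p.2‖ ^ ((n : ℝ) + 2 * σ)) := by fun_prop
  exact ((((hw hu).mul (hw hv)).mul hl.aemeasurable).div hr.aemeasurable).aestronglyMeasurable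

lemma hasDerivAt_derivIntegrand {n : ℕ} (m : ℕ) (u v : EuclideanSpace ℝ (Fin n) → ℝ) (σ : ℝ)
    (p : EuclideanSpace ℝ (Fin n) × EuclideanSpace ℝ (Fin n)) :
    HasDerivAt (fun τ => derivIntegrand m u v τ p) (-2 * derivIntegrand (m + 1) u v σ p) σ := by
  rcases (norm_nonneg (p.1 - p.2)).eq_or_lt with h0 | hr
  · have : p.1 = p.2 := sub_eq_zero.1 (norm_eq_zero.1 h0.symm)
    simpa [derivIntegrand, this] using hasDerivAt_const σ (0 : ℝ)
  have h1 : HasDerivAt (fun τ : ℝ => -((n : ℝ) + 2 * τ)) (-(2 * 1)) σ :=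
    (((hasDerivAt_id σ).const_mul 2).const_add (n : ℝ)).neg
  have h2 := (h1.const_rpow hr).const_mul
    ((u p.1 - u p.2) * (v p.1 - v p.2) * Real.log ‖p.1 - p.2‖ ^ m)
  simp only [derivIntegrand, div_eq_mul_inv, ← Real.rpow_neg hr.le]
  exact h2.congr_deriv (by ring)

/-! ### Bounds on the form and differentiation under the integral -/

section Form

variable {n : ℕ} {Ω : Set (EuclideanSpace ℝ (Fin n))} {R t t' ε : ℝ}
  {u v : EuclideanSpace ℝ (Fin n) → ℝ}

lemma integrable_derivIntegrand (hn : 1 ≤ n) (hR : 0 < R) (hΩ : Ω ⊆ Metric.closedBall 0 R)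
    (ht : 0 < t) (ht' : 0 < t') (hε : 0 < ε) (hu : MemHOmega Ω t u) (hv : MemHOmega Ω t' v)
    (m : ℕ) {σ : ℝ} (h : 2 * σ < t + t') (h' : ε < 2 * σ) :
    Integrable (derivIntegrand m u v σ) := by
  refine ((integrable_weightedDiff_mul hn hR hΩ ht ht' hε hu hv).1.const_mul
    (logConst m (t + t' - 2 * σ) (2 * σ - ε))).mono'
    (aestronglyMeasurable_derivIntegrand m σ hu.memLp.1 hv.memLp.1) (ae_of_all _ fun p => ?_)
  exact abs_derivIntegrand_le m (by linarith) (by linarith) (by linarith) (by linarith) u v p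

lemma abs_bilinFormDeriv_le (hn : 1 ≤ n) (hR : 0 < R) (hΩ : Ω ⊆ Metric.closedBall 0 R)
    (ht : 0 < t) (ht' : 0 < t') (hε : 0 < ε) (hu : MemHOmega Ω t u) (hv : MemHOmega Ω t' v)
    (m : ℕ) (δ : ℝ) {γ γ' σ : ℝ} (hγ : 0 < γ) (hγ' : 0 < γ') (h : 2 * σ + γ ≤ t + t')
    (h' : ε + γ' ≤ 2 * σ) :
    |bilinFormDeriv m δ u v σ| ≤ 2 ^ m * (logConst m γ γ' *
      (√(energyConst n R t ε) * normHOmega t u *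
        (√(energyConst n R t' ε) * normHOmega t' v))) := by
  obtain ⟨hint, hle⟩ := integrable_weightedDiff_mul hn hR hΩ ht ht' hε hu hv
  have hc : 0 ≤ logConst m γ γ' := by unfold logConst; positivity
  rw [bilinFormDeriv, abs_mul, abs_pow, abs_neg, abs_two]
  refine mul_le_mul_of_nonneg_left ?_ (by positivity)
  calc |∫ p in strip n δ, derivIntegrand m u v σ p|
      ≤ ∫ p in strip n δ, |derivIntegrand m u v σ p| := abs_integral_le_integral_abs
    _ ≤ ∫ p, |derivIntegrand m u v σ p| :=
        setIntegral_le_integral (integrable_derivIntegrand hn hR hΩ ht ht' hε hu hv m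
          (by linarith) (by linarith)).abs (ae_of_all _ fun p => abs_nonneg _)
    _ ≤ ∫ p, logConst m γ γ' * (weightedDiff t ε u p * weightedDiff t' ε v p) :=
        integral_mono (integrable_derivIntegrand hn hR hΩ ht ht' hε hu hv m
          (by linarith) (by linarith)).abs (hint.const_mul _)
          (fun p => abs_derivIntegrand_le m hγ hγ' h h' u v p)
    _ ≤ _ := by
        rw [integral_const_mul]
        exact mul_le_mul_of_nonneg_left hle hc

lemma hasDerivAt_bilinFormDeriv (hn : 1 ≤ n) (hR : 0 < R) (hΩ : Ω ⊆ Metric.closedBall 0 R)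
    (ht : 0 < t) (ht' : 0 < t') (hε : 0 < ε) (hu : MemHOmega Ω t u) (hv : MemHOmega Ω t' v)
    (m : ℕ) (δ : ℝ) {σ : ℝ} (h : 2 * σ < t + t') (h' : ε < 2 * σ) :
    HasDerivAt (bilinFormDeriv m δ u v) (bilinFormDeriv (m + 1) δ u v σ) σ := by
  -- Half of each gap is reserved for the bound; the other half leaves room for `τ` to move around
  -- `σ` under a single majorant.
  set γ := (t + t' - 2 * σ) / 2 with hγ
  set γ' := (2 * σ - ε) / 2 with hγ'
  have hγ0 : 0 < γ := by linarith
  have hγ0' : 0 < γ' := by linarith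
  have hnhds : Ioo (σ - γ' / 2) (σ + γ / 2) ∈ nhds σ :=
    Ioo_mem_nhds (by linarith) (by linarith)
  have key := (hasDerivAt_integral_of_dominated_loc_of_deriv_le
    (μ := volume.restrict (strip n δ)) (F := derivIntegrand m u v)
    (F' := fun σ p => -2 * derivIntegrand (m + 1) u v σ p)
    (bound := fun p => 2 * (logConst (m + 1) γ γ' *
      (weightedDiff t ε u p * weightedDiff t' ε v p))) hnhds
    (Filter.Eventually.of_forall fun τ =>
      (aestronglyMeasurable_derivIntegrand m τ hu.memLp.1 hv.memLp.1).restrict)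
    (integrable_derivIntegrand hn hR hΩ ht ht' hε hu hv m h h').restrict
    ((aestronglyMeasurable_derivIntegrand (m + 1) σ hu.memLp.1 hv.memLp.1).const_mul _).restrict
    (ae_of_all _ fun p τ hτ => ?_)
    (((integrable_weightedDiff_mul hn hR hΩ ht ht' hε hu hv).1.const_mul _).const_mul _).restrict
    (ae_of_all _ fun p τ _ => hasDerivAt_derivIntegrand m u v τ p)).2
  · have h2 := key.const_mul ((-2 : ℝ) ^ m)
    rw [integral_const_mul, ← mul_assoc, ← pow_succ] at h2
    exact h2
  · rw [Real.norm_eq_abs, abs_mul, abs_neg, abs_two]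
    exact mul_le_mul_of_nonneg_left (abs_derivIntegrand_le (m + 1) hγ0 hγ0'
      (by linarith [hτ.2]) (by linarith [hτ.1]) u v p) zero_le_two

end Form

/-! ### Iterated derivatives and the Lipschitz constant -/

/-- A sequence of functions on an open set, each of which is the derivative of the preceding one,
consists of the iterated derivatives of the first. -/
lemma contDiffOn_and_iteratedDeriv_of_hasDerivAt_succ {F : ℕ → ℝ → ℝ} {I : Set ℝ} (hI : IsOpen I)
    (hF : ∀ m, ∀ x ∈ I, HasDerivAt (F m) (F (m + 1) x) x) (k : ℕ) :
    (∀ m, ContDiffOn ℝ k (F m) I) ∧ ∀ x ∈ I, iteratedDeriv k (F 0) x = F k x := by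
  -- Smoothness is carried for all `F m` at once, since the derivative of `F m` is `F (m + 1)`.
  induction k with
  | zero =>
    refine ⟨fun m => ?_, fun x _ => by simp⟩
    exact contDiffOn_zero.2 fun x hx => (hF m x hx).continuousAt.continuousWithinAt
  | succ k ih =>
    refine ⟨fun m => ?_, fun x hx => ?_⟩
    · rw [Nat.cast_succ, contDiffOn_succ_iff_deriv_of_isOpen hI]
      refine ⟨fun x hx => (hF m x hx).differentiableAt.differentiableWithinAt, by simp, ?_⟩
      exact (ih.1 (m + 1)).congr fun x hx => (hF m x hx).deriv
    · rw [iteratedDeriv_succ, ← (hF k x hx).deriv]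
      exact Filter.EventuallyEq.deriv_eq (Filter.eventuallyEq_of_mem (hI.mem_nhds hx) ih.2)

lemma bilinFormDeriv_zero {n : ℕ} (δ : ℝ) (u v : EuclideanSpace ℝ (Fin n) → ℝ) :
    bilinFormDeriv 0 δ u v = bilinForm δ u v := by
  funext σ
  simp [bilinFormDeriv, bilinForm, derivIntegrand]

/-- The Lipschitz constant of the `k`-th derivative, for `Ω` in the ball of radius `R`. -/
def lipConst (n k : ℕ) (R θ : ℝ) (q : ℝ × ℝ) : ℝ :=
  2 ^ (k + 1) * logConst (k + 1) ((1 - θ) * q.2) q.1 *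
    (√(energyConst n R (q.1 + q.2) q.1) * √(energyConst n R q.1 q.1))

lemma continuousOn_lipConst (n k : ℕ) {R θ : ℝ} (hR : 0 < R) (hθ : θ < 1) :
    ContinuousOn (lipConst n k R θ)
      {q : ℝ × ℝ | 0 < q.1 ∧ q.1 < 1 ∧ 0 < q.2 ∧ q.2 < 1 - q.1} := by
  have hb : Continuous fun e : ℝ => (2 * R + 2) ^ e :=
    Real.continuous_const_rpow (by positivity)
  have h1 : ∀ q ∈ {q : ℝ × ℝ | 0 < q.1 ∧ q.1 < 1 ∧ 0 < q.2 ∧ q.2 < 1 - q.1}, q.1 ≠ 0 :=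
    fun q hq => hq.1.ne'
  have h2 : ∀ q ∈ {q : ℝ × ℝ | 0 < q.1 ∧ q.1 < 1 ∧ 0 < q.2 ∧ q.2 < 1 - q.1},
      (1 - θ) * q.2 ≠ 0 :=
    fun q hq => (mul_pos (sub_pos.2 hθ) hq.2.2.1).ne'
  have hE : ∀ {f : ℝ × ℝ → ℝ}, Continuous f → ContinuousOn (fun q => energyConst n R (f q) q.1)
      {q : ℝ × ℝ | 0 < q.1 ∧ q.1 < 1 ∧ 0 < q.2 ∧ q.2 < 1 - q.1} := fun hf =>
    continuousOn_const.add (ContinuousOn.mul (continuousOn_const.mul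
      (continuousOn_const.div continuousOn_fst h1))
      (hb.comp (continuous_const.add (hf.const_mul 2))).continuousOn)
  have hL : ContinuousOn (fun q : ℝ × ℝ => logConst (k + 1) ((1 - θ) * q.2) q.1)
      {q : ℝ × ℝ | 0 < q.1 ∧ q.1 < 1 ∧ 0 < q.2 ∧ q.2 < 1 - q.1} :=
    ((continuousOn_const.div (continuousOn_const.mul continuousOn_snd) h2).pow _).add
      ((continuousOn_const.div continuousOn_fst h1).pow _)
  exact (continuousOn_const.mul hL).mul ((hE (continuous_fst.add continuous_snd)).sqrt.mul
    (hE continuous_fst).sqrt)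

end NonlocalForm

end

theorem proposition3p2 (n : ℕ) (hn : 1 ≤ n) (Ω : Set (EuclideanSpace ℝ (Fin n)))
    (hΩ : NonlocalForm.IsSmoothBoundedDomain Ω) (k : ℕ) (hk : 1 ≤ k)
    (θ : ℝ) (hθ0 : 0 < θ) (hθ1 : θ < 1) :
    -- the constant, a continuous function of `(s, α)` that does not depend on `δ`, `η`, `u`, `v`
    ∃ C : ℝ × ℝ → ℝ,
      ContinuousOn C {q : ℝ × ℝ | 0 < q.1 ∧ q.1 < 1 ∧ 0 < q.2 ∧ q.2 < 1 - q.1} ∧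
      ∀ δ : ℝ, 0 < δ → ∀ s α : ℝ, 0 < s → s < 1 → 0 < α → α < 1 - s →
        ∀ u v : EuclideanSpace ℝ (Fin n) → ℝ,
          NonlocalForm.MemHOmega Ω (s + α) u → NonlocalForm.MemHOmega Ω s v →
          -- the `k`-th derivative exists at each `σ ∈ [s, s + α/2)`, and is the stated integral
          (∀ σ : ℝ, s ≤ σ → σ < s + α / 2 →
            MeasureTheory.IntegrableOn (NonlocalForm.derivIntegrand k u v σ)
              (NonlocalForm.strip n δ) MeasureTheory.volume ∧
            ContDiffAt ℝ k (NonlocalForm.bilinForm δ u v) σ ∧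
            iteratedDeriv k (NonlocalForm.bilinForm δ u v) σ =
              NonlocalForm.bilinFormDeriv k δ u v σ) ∧
          -- the Lipschitz estimate
          (∀ η : ℝ, 0 < η → η ≤ θ * (α / 2) →
            |NonlocalForm.bilinFormDeriv k δ u v s - NonlocalForm.bilinFormDeriv k δ u v (s + η)|
              ≤ C (s, α) * η * NonlocalForm.normHOmega (s + α) u * NonlocalForm.normHOmega s v) := by
  open NonlocalForm in
  obtain ⟨R, hR, hΩR⟩ := hΩ.isBounded.subset_closedBall_lt 0 0
  refine ⟨lipConst n k R θ, continuousOn_lipConst n k hR hθ1, ?_⟩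
  intro δ _ s α hs _ hα _ u v hu hv
  have hsα : 0 < s + α := by positivity
  -- The choice `ε = s` turns `ε < 2σ` into `s / 2 < σ`, so the open interval contains the endpoint
  -- `σ = s`.
  have hderiv : ∀ m, ∀ σ ∈ Ioo (s / 2) (s + α / 2),
      HasDerivAt (bilinFormDeriv m δ u v) (bilinFormDeriv (m + 1) δ u v σ) σ := fun m σ hσ =>
    hasDerivAt_bilinFormDeriv hn hR hΩR hsα hs hs hu hv m δ (by linarith [hσ.2])
      (by linarith [hσ.1])
  refine ⟨fun σ hσ hσ' => ?_, fun η hη hη' => ?_⟩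
  · have hmem : σ ∈ Ioo (s / 2) (s + α / 2) := ⟨by linarith, hσ'⟩
    obtain ⟨h1, h2⟩ := contDiffOn_and_iteratedDeriv_of_hasDerivAt_succ
      (F := fun m => bilinFormDeriv m δ u v) isOpen_Ioo hderiv k
    refine ⟨(integrable_derivIntegrand hn hR hΩR hsα hs hs hu hv k (by linarith)
      (by linarith)).integrableOn, ?_, ?_⟩
    · rw [← bilinFormDeriv_zero]
      exact (h1 0).contDiffAt (isOpen_Ioo.mem_nhds hmem)
    · rw [← bilinFormDeriv_zero]
      exact h2 σ hmem
  · have hθα : θ * α < α := by nlinarith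
    -- For `σ ≤ s + η` one has `2σ ≤ 2s + θα`, which leaves the gap `(1 - θ)α` near the diagonal; at
    -- infinity `2σ - ε ≥ 2s - s = s`.
    have hmv := (convex_Icc s (s + η)).norm_image_sub_le_of_norm_hasDerivWithin_le
      (f := bilinFormDeriv k δ u v) (f' := bilinFormDeriv (k + 1) δ u v)
      (fun σ hσ => (hderiv k σ ⟨by linarith [hσ.1], by linarith [hσ.2]⟩).hasDerivWithinAt)
      (fun σ hσ => abs_bilinFormDeriv_le hn hR hΩR hsα hs hs hu hv (k + 1) δ
        (γ := (1 - θ) * α) (γ' := s) (mul_pos (sub_pos.2 hθ1) hα) hs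
        (by linarith [hσ.2]) (by linarith [hσ.1]))
      (right_mem_Icc.2 (by linarith)) (left_mem_Icc.2 (by linarith))
    rw [Real.norm_eq_abs, Real.norm_eq_abs, abs_sub_comm s, add_sub_cancel_left,
      abs_of_pos hη] at hmv
    refine hmv.trans (le_of_eq ?_)
    rw [lipConst]
    ring
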